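/- Let $(R,\mathfrak m)$ be a commutative noetherian local ring which is not artinian. A nonzero $R$-module $L$ is called \emph{Lichtenbaum} if, for every finitely generated $R$-module $F$, the vanishing $\operatorname{Tor}_1^R(L,F)=0$ implies that $F$ is free. Let $L$ be a Lichtenbaum $R$-module of finite length with $\operatorname{pd}_R(L)=\infty$. Then $\ell(\operatorname{Syz}_i(L))=\infty$ for all $i>0$, where $\ell$ denotes length and $\operatorname{Syz}_i(L)=\operatorname{im}(F_i\to F_{i-1})$ is the $i$-th syzygy module of $L$ with respect to a resolution $\cdots\to F_1\to F_0\to L\to 0$ by finitely generated free $R$-modules. This holds for every such resolution, in particular for the minimal one. -/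

import Mathlib

open CategoryTheory

universe u

/-- `Tor₁ᴿ(L, F) = 0`, where `Tor` is Mathlib's functor `Tor'`: the homology of `P ⊗ F` for a
projective resolution `P` of the first argument `L`. -/
def TorOneVanishes (R : Type u) [CommRing R] (L F : Type u) [AddCommGroup L] [Module R L]
    [AddCommGroup F] [Module R F] : Prop :=
  Limits.IsZero (((Tor' (ModuleCat.{u} R) 1).obj (ModuleCat.of R L)).obj (ModuleCat.of R F))

/-- A nonzero `R`-module `L` is Lichtenbaum if every finitely generated `R`-module `F` with
`Tor₁ᴿ(L, F) = 0` is free. (Every finitely generated module is isomorphic to one in the universe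
of `R`, so the quantifier below ranges over all of them.) -/
def IsLichtenbaum (R : Type u) [CommRing R] (L : Type u) [AddCommGroup L] [Module R L] : Prop :=
  Nontrivial L ∧
    ∀ (F : Type u) [AddCommGroup F] [Module R F], Module.Finite R F →
      TorOneVanishes R L F → Module.Free R F

/-- A resolution `⋯ → Rⁿ² → Rⁿ¹ → Rⁿ⁰ → M → 0` of `M` by finitely generated free modules. -/
structure FiniteFreeResolution (R : Type u) [CommRing R] (M : Type u) [AddCommGroup M]
    [Module R M] where
  rank : ℕ → ℕ
  d : ∀ i : ℕ, (Fin (rank (i + 1)) → R) →ₗ[R] (Fin (rank i) → R)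
  aug : (Fin (rank 0) → R) →ₗ[R] M
  aug_surjective : Function.Surjective aug
  exact_zero : Function.Exact (d 0) aug
  exact_succ : ∀ i : ℕ, Function.Exact (d (i + 1)) (d i)

namespace FiniteFreeResolution

variable {R : Type u} [CommRing R] {M : Type u} [AddCommGroup M] [Module R M]

/-- The `i`-th syzygy module of `M` with respect to the resolution: `M` itself for `i = 0`, and
the image of the `i`-th differential `Rⁿⁱ → Rⁿⁱ⁻¹` for `i > 0`. -/
def syz (P : FiniteFreeResolution R M) : ℕ → ModuleCat.{u} R
  | 0 => ModuleCat.of R M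
  | i + 1 => ModuleCat.of R (LinearMap.range (P.d i))

/-- The resolution is minimal (over a local ring): all differentials vanish modulo the maximal
ideal. -/
def IsMinimal [IsLocalRing R] (P : FiniteFreeResolution R M) : Prop :=
  ∀ i : ℕ, LinearMap.range (P.d i) ≤
    IsLocalRing.maximalIdeal R • (⊤ : Submodule R (Fin (P.rank i) → R))

end FiniteFreeResolution

/-- Over a local ring, a finitely generated module has a minimal free cover. -/
theorem exists_minimal_cover (R : Type u) [CommRing R] [IsLocalRing R] (N : Type u)
    [AddCommGroup N] [Module R N] [Module.Finite R N] :
    ∃ (n : ℕ) (f : (Fin n → R) →ₗ[R] N), Function.Surjective f ∧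
      LinearMap.ker f ≤ IsLocalRing.maximalIdeal R • (⊤ : Submodule R (Fin n → R)) := by
  classical
  have hex : ∃ n : ℕ, ∃ f : (Fin n → R) →ₗ[R] N, Function.Surjective f :=
    Module.Finite.exists_fin' R N
  obtain ⟨f, hf⟩ := Nat.find_spec hex
  have hmin : ∀ m : ℕ, m < Nat.find hex → ¬ ∃ f : (Fin m → R) →ₗ[R] N, Function.Surjective f :=
    fun m hm => Nat.find_min hex hm
  generalize Nat.find hex = n at f hf hmin
  refine ⟨n, f, hf, fun v hv => ?_⟩
  have hv0 : f v = 0 := hv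
  have key : ∀ j, v j ∈ IsLocalRing.maximalIdeal R := by
    intro j
    by_contra hj
    have hu : IsUnit (v j) := by
      simpa [IsLocalRing.mem_maximalIdeal] using hj
    obtain ⟨a, ha⟩ := hu.exists_left_inv
    obtain _ | n := n
    · exact j.elim0
    refine hmin n (Nat.lt_succ_self n)
      ⟨f ∘ₗ Function.ExtendByZero.linearMap R (Fin.succAbove j), fun x => ?_⟩
    obtain ⟨w, rfl⟩ := hf x
    refine ⟨fun l => (w - (w j * a) • v) (j.succAbove l), ?_⟩
    have : Function.ExtendByZero.linearMap R (Fin.succAbove j)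
        (fun l => (w - (w j * a) • v) (j.succAbove l)) = w - (w j * a) • v := by
      funext l
      rcases Fin.eq_self_or_eq_succAbove j l with rfl | ⟨l, rfl⟩
      · simp [Function.extend, mul_assoc, ha]
      · exact Fin.succAbove_right_injective.extend_apply
          (fun l => (w - (w j * a) • v) (j.succAbove l)) 0 l
    rw [LinearMap.comp_apply, this]
    simp [hv0]
  have hsum : v = ∑ j, v j • (Pi.single j (1 : R) : Fin n → R) := by
    conv_lhs => rw [pi_eq_sum_univ' v]
  rw [hsum]
  exact Submodule.sum_mem _ fun j _ => Submodule.smul_mem_smul (key j) trivial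

/-- Over a noetherian local ring, a finitely generated module has a minimal free resolution. -/
theorem FiniteFreeResolution.exists_isMinimal (R : Type u) [CommRing R] [IsLocalRing R]
    [IsNoetherianRing R] (M : Type u) [AddCommGroup M] [Module R M] [Module.Finite R M] :
    ∃ P : FiniteFreeResolution R M, P.IsMinimal := by
  choose n f hf hker using
    fun N : {N : ModuleCat.{u} R // Module.Finite R N} =>
      haveI := N.2; exists_minimal_cover R N.1
  let next (N : {N : ModuleCat.{u} R // Module.Finite R N}) :
      {N : ModuleCat.{u} R // Module.Finite R N} :=
    ⟨ModuleCat.of R (LinearMap.ker (f N)), inferInstanceAs (Module.Finite R (LinearMap.ker (f N)))⟩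
  let S : ℕ → {N : ModuleCat.{u} R // Module.Finite R N} := fun i =>
    Nat.rec ⟨ModuleCat.of R M, inferInstanceAs (Module.Finite R M)⟩ (fun _ => next) i
  let e : ∀ i, (Fin (n (S (i + 1))) → R) →ₗ[R] (Fin (n (S i)) → R) := fun i =>
    (LinearMap.ker (f (S i))).subtype ∘ₗ (f (next (S i)))
  have hrange : ∀ i, LinearMap.range (e i) = LinearMap.ker (f (S i)) := fun i => by
    have : LinearMap.range (f (next (S i))) = ⊤ := LinearMap.range_eq_top.2 (hf (next (S i)))
    exact (LinearMap.range_comp _ _).trans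
      ((congrArg (Submodule.map _) this).trans (Submodule.map_subtype_top _))
  have hkerd : ∀ i, LinearMap.ker (e i) = LinearMap.ker (f (S (i + 1))) := fun i =>
    LinearMap.ker_comp_of_ker_eq_bot _ (Submodule.ker_subtype _)
  refine ⟨⟨fun i => n (S i), e, f (S 0), hf (S 0), ?_, fun i => ?_⟩, fun i => ?_⟩
  · exact LinearMap.exact_iff.2 (hrange 0).symm
  · exact LinearMap.exact_iff.2 ((hkerd i).trans (hrange (i + 1)).symm)
  · exact (hrange i).le.trans (hker (S i))

open TensorProduct

/-! Suppose a positive syzygy `K` of `L` has finite length. Since `pd L = ∞`, `K` is nonzero, so it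
has a socle element; as `K` lies in a free module, some coordinate of that element is a nonzero `s`
with `𝔪 s = 0`. Choose `x ∈ 𝔪` and a prime `p` with `x ∉ p`; powers of `x` kill both `L` and `K`.
For a first syzygy, a power of `x` then kills `F₀ ≠ 0`, which is impossible. Otherwise, the
null-homotopy of a power of `x` on the resolution gives `Torₖ₊₁(L, R/p) = 0`
(`exact_rTensor_of_smul_injective`). Because `s ≠ 0`, this forces `R/p` to be free
(`free_of_exact_rTensor`), hence `p = 0`, contradicting `x s = 0`. -/

theorem LinearMap.exists_comp_eq_of_range_le {R : Type*} [CommRing R] {F A B : Type*}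
    [AddCommGroup F] [Module R F] [Module.Projective R F] [AddCommGroup A] [Module R A]
    [AddCommGroup B] [Module R B] (f : F →ₗ[R] B) (g : A →ₗ[R] B)
    (h : LinearMap.range f ≤ LinearMap.range g) : ∃ t : F →ₗ[R] A, g ∘ₗ t = f := by
  obtain ⟨t, ht⟩ := Module.projective_lifting_property g.rangeRestrict
    (f.codRestrict (LinearMap.range g) fun v => h ⟨v, rfl⟩) g.surjective_rangeRestrict
  refine ⟨t, ?_⟩
  ext v
  simpa using congrArg Subtype.val (LinearMap.congr_fun ht v)

/-! ### Finite length modules and primes over a local ring. -/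

/-- Over a local ring, every element of the maximal ideal acts nilpotently on a module of finite
length. -/
theorem IsLocalRing.exists_pow_smul_eq_zero {R : Type*} [CommRing R] [IsLocalRing R]
    {M : Type*} [AddCommGroup M] [Module R M] (hM : Module.length R M ≠ ⊤) {x : R}
    (hx : x ∈ IsLocalRing.maximalIdeal R) : ∃ n : ℕ, ∀ m : M, x ^ n • m = 0 := by
  obtain ⟨_, _⟩ :=
    isFiniteLength_iff_isNoetherian_isArtinian.1 (Module.length_ne_top_iff.1 hM)
  obtain ⟨n, hn⟩ := IsArtinian.range_smul_pow_stabilizes M x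
  -- Nakayama: the stable image satisfies `xⁿM = xⁿ⁺¹M ⊆ 𝔪 xⁿM`.
  have hbot : LinearMap.range (x ^ n • LinearMap.id : M →ₗ[R] M) = ⊥ :=
    Submodule.eq_bot_of_le_smul_of_le_jacobson_bot (IsLocalRing.maximalIdeal R) _
      (IsNoetherian.noetherian _) (by
        conv_lhs => rw [hn (n + 1) n.le_succ]
        rintro _ ⟨m, rfl⟩
        rw [LinearMap.smul_apply, pow_succ', mul_smul]
        exact Submodule.smul_mem_smul hx ⟨m, rfl⟩)
      (IsLocalRing.maximalIdeal_le_jacobson _)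
  refine ⟨n, fun m => ?_⟩
  have hm : x ^ n • m ∈ LinearMap.range (x ^ n • LinearMap.id : M →ₗ[R] M) := ⟨m, rfl⟩
  rwa [hbot, Submodule.mem_bot] at hm

/-- A nonzero module of finite length over a local ring has a nonzero element killed by the
maximal ideal. -/
theorem IsLocalRing.exists_ne_zero_smul_eq_zero {R : Type*} [CommRing R] [IsLocalRing R]
    {M : Type*} [AddCommGroup M] [Module R M] [Nontrivial M] [IsArtinian R M] :
    ∃ m : M, m ≠ 0 ∧ ∀ a ∈ IsLocalRing.maximalIdeal R, a • m = 0 := by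
  obtain ⟨S, hS⟩ := IsAtomic.exists_atom (Submodule R M)
  have : IsSimpleModule R S := isSimpleModule_iff_isAtom.2 hS
  have := IsSimpleModule.nontrivial R S
  obtain ⟨m, hm⟩ := exists_ne (0 : S)
  refine ⟨m, by simpa using hm, fun a ha => ?_⟩
  have hmax := IsSimpleModule.annihilator_isMaximal (R := R) (M := S)
  rw [← IsLocalRing.eq_maximalIdeal hmax, Module.mem_annihilator] at ha
  exact congrArg Subtype.val (ha m)

/-- A noetherian local ring which is not artinian has a prime ideal missing some element of the
maximal ideal. -/
theorem IsLocalRing.exists_isPrime_notMem {R : Type*} [CommRing R] [IsLocalRing R]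
    [IsNoetherianRing R] (hR : ¬ IsArtinianRing R) :
    ∃ x ∈ IsLocalRing.maximalIdeal R, ∃ p : Ideal R, p.IsPrime ∧ x ∉ p := by
  rw [isArtinianRing_iff_isNilpotent_maximalIdeal,
    Ideal.FG.isNilpotent_iff_le_nilradical (IsNoetherian.noetherian _), SetLike.not_le_iff_exists]
    at hR
  obtain ⟨x, hx, hx'⟩ := hR
  rw [mem_nilradical, nilpotent_iff_mem_prime] at hx'
  push Not at hx'
  obtain ⟨p, hp, hxp⟩ := hx'
  exact ⟨x, hx, p, hp, hxp⟩

namespace FiniteFreeResolution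

variable {R : Type u} [CommRing R] {L : Type u} [AddCommGroup L] [Module R L]

/-! ### Computing `Tor` from a given free resolution. -/

/-- The complex of `R`-modules underlying a resolution. -/
noncomputable def complex (P : FiniteFreeResolution R L) : ChainComplex (ModuleCat.{u} R) ℕ :=
  ChainComplex.of (fun i => ModuleCat.of R (Fin (P.rank i) → R)) (fun i => ModuleCat.ofHom (P.d i))
    fun i => by
      rw [← ModuleCat.ofHom_comp, (P.exact_succ i).linearMap_comp_eq_zero]
      rfl

theorem complex_d (P : FiniteFreeResolution R L) (i : ℕ) :
    P.complex.d (i + 1) i = ModuleCat.ofHom (P.d i) :=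
  ChainComplex.of_d (fun i => ModuleCat.of R (Fin (P.rank i) → R))
    (fun i => ModuleCat.ofHom (P.d i)) i

theorem complex_d_comp_aug (P : FiniteFreeResolution R L) :
    P.complex.d 1 0 ≫ ModuleCat.ofHom P.aug = 0 := by
  rw [complex_d]
  exact ModuleCat.hom_ext P.exact_zero.linearMap_comp_eq_zero

theorem complex_exactAt_succ (P : FiniteFreeResolution R L) (i : ℕ) :
    P.complex.ExactAt (i + 1) := by
  rw [HomologicalComplex.exactAt_iff' _ (i + 2) (i + 1) i (by simp) (by simp)]
  refine ModuleCat.shortComplex_exact _ ?_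
  change Function.Exact (P.complex.d (i + 2) (i + 1)) (P.complex.d (i + 1) i)
  rw [complex_d, complex_d]
  exact P.exact_succ i

/-- A resolution by finitely generated free modules, as a projective resolution. -/
noncomputable def projectiveResolution (P : FiniteFreeResolution R L) :
    ProjectiveResolution (ModuleCat.of R L) where
  complex := P.complex
  projective n := (IsProjective.iff_projective (Fin (P.rank n) → R)).1 inferInstance
  π := (ChainComplex.toSingle₀Equiv _ _).symm ⟨ModuleCat.ofHom P.aug, P.complex_d_comp_aug⟩
  quasiIso := ⟨fun n => by
    cases n with
    | zero =>
      rw [ChainComplex.quasiIsoAt₀_iff, ShortComplex.quasiIso_iff_of_zeros']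
      · refine (ShortComplex.exact_and_epi_g_iff_of_iso
          (S₂ := ShortComplex.mk _ _ P.complex_d_comp_aug) ?_).2 ⟨?_, ?_⟩
        · exact ShortComplex.isoMk (Iso.refl _) (Iso.refl _) (Iso.refl _)
            ((Category.id_comp _).trans (Category.comp_id _).symm)
            ((Category.id_comp _).trans (((Category.comp_id _).trans
              (ChainComplex.toSingle₀Equiv_symm_apply_f_zero _ P.complex_d_comp_aug)).symm))
        · refine ModuleCat.shortComplex_exact _ ?_
          change Function.Exact (P.complex.d 1 0) P.aug
          rw [complex_d]
          exact P.exact_zero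
        · exact (ModuleCat.epi_iff_surjective _).2 P.aug_surjective
      all_goals rfl
    | succ n =>
      rw [quasiIsoAt_iff_exactAt']
      · exact P.complex_exactAt_succ n
      · exact ChainComplex.exactAt_succ_single_obj _ _⟩

theorem torOneVanishes (P : FiniteFreeResolution R L) (M : Type u) [AddCommGroup M] [Module R M]
    (h : Function.Exact ((P.d 1).rTensor M) ((P.d 0).rTensor M)) : TorOneVanishes R L M := by
  refine Limits.IsZero.of_iso ?_ (P.projectiveResolution.isoLeftDerivedObj
    ((MonoidalCategory.tensoringRight (ModuleCat.{u} R)).obj (ModuleCat.of R M)) 1)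
  refine (HomologicalComplex.exactAt_iff_isZero_homology _ _).1 ?_
  rw [HomologicalComplex.exactAt_iff' _ 2 1 0 (by simp) (by simp)]
  refine ModuleCat.shortComplex_exact _ ?_
  change Function.Exact (MonoidalCategory.whiskerRight (P.complex.d 2 1) (ModuleCat.of R M))
    (MonoidalCategory.whiskerRight (P.complex.d 1 0) (ModuleCat.of R M))
  rw [complex_d, complex_d]
  exact h

/-- Dimension shifting: `Torⱼ₊₂(L, M) = 0` implies `Torⱼ₊₁(L, N) = 0` when `N` is the kernel of a
surjection from a flat module to `M`. -/
theorem exact_rTensor_of_shortExact (P : FiniteFreeResolution R L) (k : ℕ) {N G M : Type u}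
    [AddCommGroup N] [Module R N] [AddCommGroup G] [Module R G] [Module.Flat R G]
    [AddCommGroup M] [Module R M] {f : N →ₗ[R] G} {g : G →ₗ[R] M} (hf : Function.Injective f)
    (hfg : Function.Exact f g) (hg : Function.Surjective g)
    (h : Function.Exact ((P.d (k + 2)).rTensor M) ((P.d (k + 1)).rTensor M)) :
    Function.Exact ((P.d (k + 1)).rTensor N) ((P.d k).rTensor N) := by
  have comm : ∀ {A B : Type u} [AddCommGroup A] [Module R A] [AddCommGroup B] [Module R B]
      (φ : A →ₗ[R] B) (i : ℕ) (z : (Fin (P.rank (i + 1)) → R) ⊗[R] A),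
      φ.lTensor (Fin (P.rank i) → R) ((P.d i).rTensor A z) =
        (P.d i).rTensor B (φ.lTensor (Fin (P.rank (i + 1)) → R) z) := fun φ i z => by
    rw [← LinearMap.comp_apply, ← LinearMap.comp_apply, LinearMap.lTensor_comp_rTensor,
      LinearMap.rTensor_comp_lTensor]
  have dd : ∀ (A : Type u) [AddCommGroup A] [Module R A] (i : ℕ)
      (z : (Fin (P.rank (i + 2)) → R) ⊗[R] A),
      (P.d i).rTensor A ((P.d (i + 1)).rTensor A z) = 0 := fun A _ _ i z => by
    rw [← LinearMap.comp_apply, ← LinearMap.rTensor_comp,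
      (P.exact_succ i).linearMap_comp_eq_zero]
    simp
  have inj : ∀ i, Function.Injective (f.lTensor (Fin (P.rank i) → R)) := fun i =>
    Module.Flat.lTensor_preserves_injective_linearMap f hf
  have mid : ∀ i, Function.Exact (f.lTensor (Fin (P.rank i) → R))
      (g.lTensor (Fin (P.rank i) → R)) := fun i => lTensor_exact _ hfg hg
  intro a
  refine ⟨fun ha => ?_, ?_⟩
  -- Pushed into `G`, the cycle `a` bounds some `b`, whose image over `M` is a cycle, hence a
  -- boundary by `h`. Subtracting a lift of that boundary moves `b` into the part coming from `N`.
  · obtain ⟨b, hb⟩ := (Module.Flat.rTensor_exact G (P.exact_succ k) (f.lTensor _ a)).1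
      (by rw [← comm, ha, map_zero])
    obtain ⟨c, hc⟩ := (h (g.lTensor _ b)).1 (by rw [← comm, hb, (mid _).apply_apply_eq_zero])
    obtain ⟨c, rfl⟩ := LinearMap.lTensor_surjective _ hg c
    obtain ⟨b', hb'⟩ := (mid _ (b - (P.d (k + 2)).rTensor G c)).1
      (by rw [map_sub, comm, hc, sub_self])
    refine ⟨b', inj _ ?_⟩
    rw [comm, hb', map_sub, hb, dd, sub_zero]
  · rintro ⟨b, rfl⟩
    exact dd N k b

/-! ### Vanishing of `Tor` and its consequences. -/

/-- An element annihilating the resolved module acts null-homotopically on a resolution. -/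
theorem exists_homotopy (P : FiniteFreeResolution R L) {r : R} (hr : ∀ l : L, r • l = 0) (k : ℕ) :
    ∃ (s : (Fin (P.rank k) → R) →ₗ[R] (Fin (P.rank (k + 1)) → R))
      (t : (Fin (P.rank (k + 1)) → R) →ₗ[R] (Fin (P.rank (k + 2)) → R)),
      ∀ v, P.d (k + 1) (t v) + s (P.d k v) = r • v := by
  induction k with
  | zero =>
    obtain ⟨s, hs⟩ := LinearMap.exists_comp_eq_of_range_le (r • LinearMap.id) (P.d 0) (by
      rintro _ ⟨v, rfl⟩
      exact (P.exact_zero _).1 (by simp [hr]))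
    obtain ⟨t, ht⟩ := LinearMap.exists_comp_eq_of_range_le (r • LinearMap.id - s ∘ₗ P.d 0)
      (P.d 1) (by
        rintro _ ⟨v, rfl⟩
        refine (P.exact_succ 0 _).1 ?_
        have : P.d 0 (s (P.d 0 v)) = r • P.d 0 v := LinearMap.congr_fun hs (P.d 0 v)
        simp [this])
    exact ⟨s, t, fun v => by
      have : P.d 1 (t v) = r • v - s (P.d 0 v) := LinearMap.congr_fun ht v
      rw [this, sub_add_cancel]⟩
  | succ k ih =>
    obtain ⟨s, t, h⟩ := ih
    obtain ⟨t', ht'⟩ := LinearMap.exists_comp_eq_of_range_le (r • LinearMap.id - t ∘ₗ P.d (k + 1))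
      (P.d (k + 2)) (by
        rintro _ ⟨v, rfl⟩
        refine (P.exact_succ (k + 1) _).1 ?_
        have := h (P.d (k + 1) v)
        rw [(P.exact_succ k).apply_apply_eq_zero] at this
        simp_all)
    exact ⟨t, t', fun v => by
      have : P.d (k + 2) (t' v) = r • v - t (P.d (k + 1) v) := LinearMap.congr_fun ht' v
      rw [this, sub_add_cancel]⟩

/-- If `r` annihilates `L` and `y` annihilates a syzygy `im dₖ₊₁`, then a module on which `y * r`
is regular has no `Tor` with `L` in degree `k + 1`. -/
theorem exact_rTensor_of_smul_injective (P : FiniteFreeResolution R L) {r y : R}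
    (hr : ∀ l : L, r • l = 0) (k : ℕ) (hy : ∀ v, y • P.d (k + 1) v = 0) (M : Type u)
    [AddCommGroup M] [Module R M] (hM : Function.Injective fun m : M => (y * r) • m) :
    Function.Exact ((P.d (k + 1)).rTensor M) ((P.d k).rTensor M) := by
  obtain ⟨s, t, h⟩ := P.exists_homotopy hr k
  -- Multiplying the homotopy identity by `y` removes its `P.d (k + 1)` term, so `P.d k` has a left
  -- inverse up to `y * r`.
  have hs : (y • s) ∘ₗ P.d k = (y * r) • LinearMap.id := LinearMap.ext fun v => by
    have := congrArg (y • ·) (h v)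
    simpa [smul_add, hy, mul_smul] using this
  have hinj : Function.Injective ((P.d k).rTensor M) := by
    have h1 : Function.Injective
        ((LinearMap.lsmul R M (y * r)).lTensor (Fin (P.rank (k + 1)) → R)) :=
      Module.Flat.lTensor_preserves_injective_linearMap _ hM
    have h2 : (y • s).rTensor M ∘ₗ (P.d k).rTensor M =
        (LinearMap.lsmul R M (y * r)).lTensor (Fin (P.rank (k + 1)) → R) := by
      rw [← LinearMap.rTensor_comp, hs]
      ext
      simp
    rw [← h2, LinearMap.coe_comp] at h1
    exact h1.of_comp
  intro a
  refine ⟨fun ha => ⟨0, ?_⟩, ?_⟩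
  · rw [map_zero, hinj (ha.trans (map_zero _).symm)]
  · rintro ⟨b, rfl⟩
    rw [← LinearMap.comp_apply, ← LinearMap.rTensor_comp,
      (P.exact_succ k).linearMap_comp_eq_zero]
    simp

/-- Over a local ring with nonzero socle, the vanishing of a single `Tor` in positive degree
against a Lichtenbaum module forces a finitely generated module to be free. -/
theorem free_of_exact_rTensor [IsLocalRing R] [IsNoetherianRing R] (P : FiniteFreeResolution R L)
    (hL : IsLichtenbaum R L) {s : R} (hs0 : s ≠ 0)
    (hs : ∀ a ∈ IsLocalRing.maximalIdeal R, a * s = 0) (k : ℕ) (M : Type u) [AddCommGroup M]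
    [Module R M] [Module.Finite R M]
    (h : Function.Exact ((P.d (k + 1)).rTensor M) ((P.d k).rTensor M)) : Module.Free R M := by
  induction k generalizing M with
  | zero => exact hL.2 M inferInstance (P.torOneVanishes M h)
  | succ k ih =>
    obtain ⟨n, f, hf, hker⟩ := exists_minimal_cover R M
    have hfree : Module.Free R (LinearMap.ker f) := ih _
      (P.exact_rTensor_of_shortExact k (LinearMap.ker f).injective_subtype
        f.exact_subtype_ker_map hf h)
    -- By minimality the kernel lies in `𝔪Rⁿ`, which `s` kills; a nonzero free module is faithful,
    -- so the kernel vanishes.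
    have hsker : ∀ v : LinearMap.ker f, s • v = 0 := fun v => by
      have hv := (Submodule.smul_le (P := LinearMap.ker (LinearMap.lsmul R (Fin n → R) s))).2
        (fun a ha w _ => by
          rw [LinearMap.mem_ker, LinearMap.lsmul_apply, smul_smul, mul_comm, hs a ha, zero_smul])
        (hker v.2)
      exact Subtype.ext (by simpa using hv)
    have hbot : LinearMap.ker f = ⊥ := by
      by_contra hne
      have : Nontrivial (LinearMap.ker f) := Submodule.nontrivial_iff_ne_bot.2 hne
      exact hs0 (FaithfulSMul.eq_of_smul_eq_smul (α := LinearMap.ker f) fun v => by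
        rw [hsker, zero_smul])
    exact Module.Free.of_equiv (LinearEquiv.ofBijective f ⟨LinearMap.ker_eq_bot.1 hbot, hf⟩)

/-- Each step down the resolution raises the bound by one. The case `n = 0`, a zero syzygy, shows
that infinite projective dimension makes every syzygy nonzero. -/
theorem hasProjectiveDimensionLT_range (P : FiniteFreeResolution R L) (i n : ℕ)
    (h : HasProjectiveDimensionLT (ModuleCat.of R (LinearMap.range (P.d i))) n) :
    HasProjectiveDimensionLT (ModuleCat.of R L) (n + i + 1) := by
  have proj (j : ℕ) : Projective (ModuleCat.of R (Fin (P.rank j) → R)) :=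
    (IsProjective.iff_projective _).1 inferInstance
  induction i generalizing n with
  | zero =>
    rw [← LinearMap.exact_iff.1 P.exact_zero] at h
    exact (LinearMap.shortExact_shortComplexKer P.aug_surjective).hasProjectiveDimensionLT_X₃ n h
      (@hasProjectiveDimensionLT_of_ge _ _ _ _ 1 _ (by omega)
        (projective_iff_hasProjectiveDimensionLT_one.1 (proj 0)))
  | succ i ih =>
    rw [← LinearMap.exact_iff.1 (P.exact_succ i), ← LinearMap.ker_rangeRestrict] at h
    have := ih (n + 1) ((LinearMap.shortExact_shortComplexKer
      (P.d i).surjective_rangeRestrict).hasProjectiveDimensionLT_X₃ n h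
        (@hasProjectiveDimensionLT_of_ge _ _ _ _ 1 _ (by omega)
          (projective_iff_hasProjectiveDimensionLT_one.1 (proj (i + 1)))))
    rwa [show n + (i + 1) + 1 = n + 1 + i + 1 by omega]

end FiniteFreeResolution

theorem mainTheorem8 (R : Type u) [CommRing R] [IsLocalRing R] [IsNoetherianRing R]
    (hR : ¬ IsArtinianRing R)
    (L : Type u) [AddCommGroup L] [Module R L]
    (hL : IsLichtenbaum R L)
    (hpd : projectiveDimension (ModuleCat.of R L) = ⊤)
    (hlen : Module.length R L ≠ ⊤)
    (P : FiniteFreeResolution R L) (i : ℕ) (hi : 0 < i) :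
    Module.length R (P.syz i) = ⊤ := by
  obtain _ | i := i
  · exact absurd hi (lt_irrefl 0)
  by_contra hK
  change Module.length R (LinearMap.range (P.d i)) ≠ ⊤ at hK
  obtain ⟨-, _⟩ :=
    isFiniteLength_iff_isNoetherian_isArtinian.1 (Module.length_ne_top_iff.1 hK)
  have : Nontrivial (LinearMap.range (P.d i)) := by
    by_contra hsub
    rw [not_nontrivial_iff_subsingleton] at hsub
    exact (projectiveDimension_ne_top_iff _).2 ⟨_, P.hasProjectiveDimensionLT_range i 0
      (ModuleCat.isZero_of_subsingleton _).hasProjectiveDimensionLT_zero⟩ hpd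
  obtain ⟨⟨v, hv⟩, hv0, hmv⟩ :=
    IsLocalRing.exists_ne_zero_smul_eq_zero (R := R) (M := LinearMap.range (P.d i))
  obtain ⟨j, hj⟩ : ∃ j, v j ≠ 0 := by
    by_contra! h
    exact hv0 (Subtype.ext (funext h))
  have hs : ∀ a ∈ IsLocalRing.maximalIdeal R, a * v j = 0 := fun a ha =>
    congrFun (congrArg Subtype.val (hmv a ha)) j
  obtain ⟨x, hx, p, hp, hxp⟩ := IsLocalRing.exists_isPrime_notMem hR
  obtain ⟨a, ha⟩ := IsLocalRing.exists_pow_smul_eq_zero hlen hx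
  obtain ⟨b, hb⟩ := IsLocalRing.exists_pow_smul_eq_zero hK hx
  have hxp' : ∀ n, x ^ n ∉ p := fun n hn => hxp (hp.mem_of_pow_mem n hn)
  obtain _ | k := i
  -- `x ^ a` maps `F₀` into the first syzygy, which `x ^ b` kills. The index `j` shows that `F₀` has
  -- positive rank.
  · have hkill : ∀ w : Fin (P.rank 0) → R, x ^ (b + a) • w = 0 := fun w => by
      obtain ⟨u, hu⟩ := (P.exact_zero (x ^ a • w)).1 (by rw [map_smul, ha])
      rw [pow_add, mul_smul, ← hu]
      exact congrArg Subtype.val (hb ⟨_, u, rfl⟩)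
    have := congrFun (hkill fun _ => 1) j
    exact hxp' (b + a) (by simp_all)
  have hfree : Module.Free R (R ⧸ p) := P.free_of_exact_rTensor hL hj hs k _
    (P.exact_rTensor_of_smul_injective ha k
      (fun v => congrArg Subtype.val (hb ⟨_, v, rfl⟩)) _ (by
        intro m m' h
        simp only [Algebra.smul_def] at h
        refine mul_left_cancel₀ (fun h0 => ?_) h
        rw [← pow_add] at h0
        exact hxp' (b + a) (Ideal.Quotient.eq_zero_iff_mem.1 h0)))
  -- The nonzero free module `R ⧸ p` is faithful, yet `p` annihilates it.
  have hp0 : ∀ z ∈ p, z = 0 := fun z hz =>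
    FaithfulSMul.eq_of_smul_eq_smul (α := R ⧸ p) fun m => by
      rw [zero_smul, Algebra.smul_def, Ideal.Quotient.algebraMap_eq,
        Ideal.Quotient.eq_zero_iff_mem.2 hz, zero_mul]
  rcases hp.mem_or_mem (hs x hx ▸ p.zero_mem : x * v j ∈ p) with h | h
  · exact hxp h
  · exact hj (hp0 _ h)
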